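/- Let $(\Gamma,S)$ be a Coxeter system with $S$ finite. For $\sigma\subseteq S$ let $\Gamma_\sigma=\langle\sigma\rangle$, and call $\sigma$ spherical if $\Gamma_\sigma$ is finite. The chamber $C$ is the simplicial complex whose simplices are the chains of spherical subsets of $S$ (the empty set included); for $s\in S$ its face $C_s$ is the union of the simplices all of whose vertices contain $s$. The Davis complex $X$ is the quotient of $\Gamma\times C$ obtained by identifying $(a,x)$ with $(b,x)$ when $a^{-1}b\in\Gamma_\sigma$ for every vertex $\sigma$ of the simplex of $C$ that contains $x$ in its interior. It carries a $\Gamma$-invariant metric inducing its topology (for instance the piecewise Euclidean CAT(0) metric; the statement holds for every such metric). The walls are the fixed point sets in $X$ of the conjugates of the elements of $S$; the face $\gamma C_s$ of the chamber $\gamma C$ lies in the wall of $\gamma s\gamma^{-1}$. Let $\phi$ be a coloring of the set of walls by a finite set $F$, and let an orientation of the walls be given, i.e. for every wall one component of its complement is called left. The geometric resolution labels the face $\gamma C_s$ of each chamber $\gamma C$ by the color of its wall and by the sign $+$ if the interior of $\gamma C$ is left of that wall, and $-$ otherwise. A tile is a copy of $C$ whose faces are labelled in this way by colors and signs. Let $\mathcal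 T$ be a set of tiles that contains all tiles occurring in the geometric resolution (for instance exactly those). The set of faces $\mathcal F$ consists of triples (shape, color, sign), the face $C_s$ having shape $\tau(s)$ for a fixed map $\tau$ on $S$ (so $\tau$ injective means that different faces of $C$ are distinguished, $\tau$ constant that faces are distinguished by color and sign only). The opposition $o:\mathcal F\to\mathcal F$ reverses the sign. The pair $(\mathcal T,\mathcal F)$ is unbalanced if there is $w:\mathcal F\to\mathbb Z$ with $w(o(f))=-w(f)$ for all $f\in\mathcal F$ and $\sum_{f\in t}w(f)>0$ for all $t\in\mathcal T$, the sum being over the faces $C_s$, $s\in S$, of $t$. A $(\mathcal T,\mathcal F)$-tiling of $X$ is a collection $\alpha=\{\varphi_\lambda:t_\lambda\to t\}$ of isometries from subsets $t_\lambda\subset X$ onto tiles $t\in\mathcal T$ (with the metric of the chamber $C\subset X$) such that 1. $X=\bigcup_\lambda t_\lambda$; 2. each $t_\lambda$ minus the union of its faces is the interior of $t_\lambda$ in $X$, and different $t_\lambda$ have disjoint interiors; 3. if $\lambda\neq\lambda'$ and $\mathrm{Int}(t_\lambda\cup t_{\lambda'})\neq \mathrm{Int}(t_\lambda)\cup\mathrm{Int}(t_{\lambda'})$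 (call such tiles adjacent), then $t_\lambda\cap t_{\lambda'}$ is a face $f$ of $t_\lambda$ and a face $o(f)$ of $t_{\lambda'}$; 4. there are no free faces: every face of every $t_\lambda$ is the intersection of $t_\lambda$ with a tile adjacent to it. The group $\mathrm{Iso}(\alpha)$ consists of the isometries $g$ of $X$ with $\{\varphi_\lambda\circ g^{-1}\}=\{\varphi_\lambda\}$, and $\alpha$ is aperiodic if $\mathrm{Iso}(\alpha)$ does not act cocompactly on $X$, i.e. if no compact subset of $X$ has translates under $\mathrm{Iso}(\alpha)$ covering $X$. **Proposition 10.** If $(\mathcal T,\mathcal F)$ is unbalanced, then every $(\mathcal T,\mathcal F)$-tiling $\alpha$ of $X$ is aperiodic. -/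

import Mathlib

noncomputable section

namespace Davis

variable {B W : Type*} [Fintype B] [Group W] {M : CoxeterMatrix B}

/-! ### The Davis complex of a Coxeter system -/

/-- The special subgroup of `W` generated by a set `σ` of simple generators. -/
def special (cs : CoxeterSystem M W) (σ : Finset B) : Subgroup W :=
  Subgroup.closure (cs.simple '' (σ : Set B))

/-- The subsets of the generating set that generate a finite subgroup. The nonempty ones are the
simplices of the nerve `N`, that is, the vertices of its barycentric subdivision `N'`; the empty
one is the cone point of `Cone N'`. -/
abbrev Spherical (cs : CoxeterSystem M W) : Type _ :=
  {σ : Finset B // Finite (special cs σ)}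

instance (cs : CoxeterSystem M W) : Fintype (Spherical cs) := Fintype.ofFinite _

/-- The chamber `C = Cone N'`: its simplices are the chains of spherical subsets, and a point of
it is given by its barycentric coordinates. The topology is that of a subspace of a finite
dimensional real vector space. -/
abbrev Chamber (cs : CoxeterSystem M W) : Type _ :=
  {x : Spherical cs → ℝ // x ∈ stdSimplex ℝ (Spherical cs) ∧
    IsChain (· ≤ ·) {σ : Spherical cs | x σ ≠ 0}}

/-- The face of the chamber that corresponds to the generator `s`: the union of the simplices
all of whose vertices are spherical subsets containing `s`. -/
def mirror (cs : CoxeterSystem M W) (s : B) : Set (Chamber cs) :=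
  {x | ∀ σ : Spherical cs, x.1 σ ≠ 0 → s ∈ σ.1}

/-- The gluing of the chambers `γ × C`: on vertices, `a × v_σ ∼ b × v_σ` when
`a⁻¹ b` lies in the special subgroup of `σ`. -/
def gluing (cs : CoxeterSystem M W) : Setoid (Σ _ : W, Chamber cs) where
  r p q := p.2 = q.2 ∧ ∀ σ : Spherical cs, p.2.1 σ ≠ 0 → p.1⁻¹ * q.1 ∈ special cs σ.1
  iseqv :=
    { refl := fun p => ⟨rfl, fun σ _ => by simp⟩
      symm := fun {p q} h => ⟨h.1.symm, fun σ hσ => by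
        have h1 := (special cs σ.1).inv_mem (h.2 σ (by rw [h.1]; exact hσ))
        simpa using h1⟩
      trans := fun {p q r} h h' => ⟨h.1.trans h'.1, fun σ hσ => by
        have h1 := (special cs σ.1).mul_mem (h.2 σ hσ) (h'.2 σ (by rw [← h.1]; exact hσ))
        simpa [mul_assoc] using h1⟩ }

/-- The Davis complex. -/
def Complex (cs : CoxeterSystem M W) : Type _ := Quotient (gluing cs)

/-- The quotient topology. -/
instance (cs : CoxeterSystem M W) : TopologicalSpace (Complex cs) :=
  inferInstanceAs (TopologicalSpace (Quotient (gluing cs)))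

/-- The quotient map `q : W × C → X`. -/
def mk (cs : CoxeterSystem M W) (γ : W) (x : Chamber cs) : Complex cs :=
  Quotient.mk (gluing cs) ⟨γ, x⟩

/-- The action of the Coxeter group on its Davis complex: `γ • [a, x] = [γ a, x]`. -/
instance (cs : CoxeterSystem M W) : MulAction W (Complex cs) where
  smul γ := Quotient.map (fun p => ⟨γ * p.1, p.2⟩) (fun p q h =>
    ⟨h.1, fun σ hσ => by simpa [mul_assoc] using h.2 σ hσ⟩)
  one_smul := by
    rintro ⟨p⟩
    exact congrArg (Quotient.mk (gluing cs)) (Sigma.ext (one_mul _) HEq.rfl)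
  mul_smul := by
    rintro a b ⟨p⟩
    exact congrArg (Quotient.mk (gluing cs)) (Sigma.ext (mul_assoc _ _ _) HEq.rfl)

/-- The chamber `γ C`. -/
def chamber (cs : CoxeterSystem M W) (γ : W) : Set (Complex cs) := Set.range (mk cs γ)

/-- A metric on the Davis complex that induces its topology and for which the Coxeter group acts
by isometries, such as the piecewise Euclidean CAT(0) metric. -/
structure InvariantMetric (cs : CoxeterSystem M W) where
  /-- the distance function -/
  dist : Complex cs → Complex cs → ℝ
  dist_self : ∀ x, dist x x = 0
  dist_comm : ∀ x y, dist x y = dist y x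
  dist_triangle : ∀ x y z, dist x z ≤ dist x y + dist y z
  eq_of_dist_eq_zero : ∀ x y, dist x y = 0 → x = y
  isOpen_iff : ∀ U : Set (Complex cs),
    IsOpen U ↔ ∀ x ∈ U, ∃ ε > 0, ∀ y, dist x y < ε → y ∈ U
  dist_smul : ∀ (γ : W) (x y : Complex cs), dist (γ • x) (γ • y) = dist x y

/-! ### Walls, orientations, geometric resolutions -/

/-- The fixed point set of an element of the Coxeter group. -/
def fixedSet (cs : CoxeterSystem M W) (r : W) : Set (Complex cs) := {x | r • x = x}

/-- The set of walls: the fixed point sets of the conjugates of the generators. -/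
def Wall (cs : CoxeterSystem M W) : Type _ :=
  {A : Set (Complex cs) // ∃ r : W, cs.IsReflection r ∧ A = fixedSet cs r}

/-- The wall that contains the `s`-face of the chamber `γ C`. -/
def wallOf (cs : CoxeterSystem M W) (γ : W) (s : B) : Wall cs :=
  ⟨fixedSet cs (γ * cs.simple s * γ⁻¹), _, ⟨γ, s, rfl⟩, rfl⟩

/-- An orientation of all walls: for every wall, the choice of a component of its complement,
which is called the left one. -/
structure Orientation (cs : CoxeterSystem M W) where
  /-- the left side of a wall -/
  left : Wall cs → Set (Complex cs)
  isComponent : ∀ A : Wall cs, ∃ x ∈ (A.1)ᶜ, left A = connectedComponentIn (A.1)ᶜ x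

/-- A tile: a copy of the chamber, each face of which carries a color and a sign. -/
abbrev Tile (B F : Type*) : Type _ := B → F × ℤˣ

open Classical in
/-- The sign of the `s`-face of the chamber `γ C`: it is `+` if the interior of the chamber is
left of the wall that contains the face, and `-` otherwise. -/
def faceSign {cs : CoxeterSystem M W} (o : Orientation cs) (γ : W) (s : B) : ℤˣ :=
  if interior (chamber cs γ) ⊆ o.left (wallOf cs γ s) then 1 else -1

/-- The tile that the geometric resolution, along the orientation `o`, of the tiling by the
coloring `φ` has at the chamber `γ C`. -/
def resolutionTile {cs : CoxeterSystem M W} {F : Type*} (φ : Wall cs → F) (o : Orientation cs)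
    (γ : W) : Tile B F :=
  fun s => (φ (wallOf cs γ s), faceSign o γ s)

/-- The tiles that occur in the geometric resolution. -/
def resolutionTiles {cs : CoxeterSystem M W} {F : Type*} (φ : Wall cs → F) (o : Orientation cs) :
    Set (Tile B F) :=
  Set.range (resolutionTile φ o)

/-! ### Faces, opposition, weight functions -/

/-- The set of signed colored faces. Here `K` is the set of shapes of faces: the `s`-face of the
chamber has the shape `τ s` for a map `τ : B → K`. With `τ` the identity, different faces of the
chamber are never identified; with `τ` constant, faces are told apart by color and sign only. -/
abbrev Face (K F : Type*) : Type _ := K × F × ℤˣ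

/-- The opposition function, which exchanges `f₊` and `f₋`. -/
def opposite {K F : Type*} (f : Face K F) : Face K F := (f.1, f.2.1, -f.2.2)

/-- The `s`-face of a tile, as an element of the set of faces. -/
def faceOf {K F : Type*} (τ : B → K) (t : Tile B F) (s : B) : Face K F := (τ s, t s)

/-- A set of tiles is unbalanced if some weight function has a positive sum on every tile. -/
def IsUnbalanced {K F : Type*} (τ : B → K) (T : Set (Tile B F)) : Prop :=
  ∃ w : Face K F → ℤ, (∀ f, w (opposite f) = -w f) ∧ ∀ t ∈ T, 0 < ∑ s, w (faceOf τ t s)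

/-! ### Tilings of the Davis complex -/

/-- A tile placed in the Davis complex: the inverse `emb` of an identification `t_λ → t`
of a subset of the complex with a tile (whose underlying complex is the chamber). -/
structure Placement (cs : CoxeterSystem M W) (F : Type*) where
  /-- the tile -/
  tile : Tile B F
  /-- the map that places it -/
  emb : Chamber cs → Complex cs

namespace Placement

variable {cs : CoxeterSystem M W} {F : Type*}

/-- The subset of the Davis complex that a placed tile occupies. -/
def carrier (p : Placement cs F) : Set (Complex cs) := Set.range p.emb

/-- The `s`-face of a placed tile. -/
def face (p : Placement cs F) (s : B) : Set (Complex cs) := p.emb '' mirror cs s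

/-- Two placed tiles are adjacent if the interior of their union is more than the union of their
interiors. -/
def Adjacent (p q : Placement cs F) : Prop :=
  interior (p.carrier ∪ q.carrier) ≠ interior p.carrier ∪ interior q.carrier

/-- Moving a placed tile by a transformation of the Davis complex. -/
def map (g : Equiv.Perm (Complex cs)) (p : Placement cs F) : Placement cs F :=
  ⟨p.tile, g ∘ p.emb⟩

end Placement

/-- A tiling of the Davis complex, with a given metric, by a set `T` of tiles. -/
structure IsTiling {cs : CoxeterSystem M W} {K F : Type*} (d : InvariantMetric cs) (τ : B → K)
    (T : Set (Tile B F)) (α : Set (Placement cs F)) : Prop where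
  /-- only tiles from `T` are used -/
  tile_mem : ∀ p ∈ α, p.tile ∈ T
  /-- every placed tile is isometric to the base chamber -/
  isometric : ∀ p ∈ α, ∀ x y, d.dist (p.emb x) (p.emb y) = d.dist (mk cs 1 x) (mk cs 1 y)
  /-- the placed tiles cover the complex -/
  cover : ⋃ p ∈ α, p.carrier = Set.univ
  /-- a placed tile without its faces is its interior in the complex -/
  interior_eq : ∀ p ∈ α, p.carrier \ ⋃ s, p.face s = interior p.carrier
  /-- different placed tiles do not overlap -/
  disjoint : ∀ p ∈ α, ∀ q ∈ α, p ≠ q → Disjoint (interior p.carrier) (interior q.carrier)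
  /-- adjacent tiles intersect along opposite faces -/
  opposite_faces : ∀ p ∈ α, ∀ q ∈ α, p ≠ q → p.Adjacent q → ∃ s s' : B,
    p.carrier ∩ q.carrier = p.face s ∧ p.carrier ∩ q.carrier = q.face s' ∧
      faceOf τ q.tile s' = opposite (faceOf τ p.tile s)
  /-- there are no free faces: along every face there is an adjacent tile -/
  no_free_face : ∀ p ∈ α, ∀ s : B, ∃ q ∈ α, p ≠ q ∧ p.Adjacent q ∧
    p.carrier ∩ q.carrier = p.face s

/-- The group of isometries of a tiling: the isometries of the Davis complex that map the
collection of placed tiles onto itself. -/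
def isometryGroup {cs : CoxeterSystem M W} {F : Type*} (d : InvariantMetric cs)
    (α : Set (Placement cs F)) : Subgroup (Equiv.Perm (Complex cs)) where
  carrier := {g | (∀ x y, d.dist (g x) (g y) = d.dist x y) ∧ Placement.map g '' α = α}
  one_mem' := ⟨fun _ _ => rfl, Set.image_id α⟩
  mul_mem' := by
    rintro g h ⟨hg, hg'⟩ ⟨hh, hh'⟩
    refine ⟨fun x y => (hg _ _).trans (hh x y), ?_⟩
    calc Placement.map (g * h) '' α = Placement.map g '' (Placement.map h '' α) :=
          (Set.image_image (Placement.map g) (Placement.map h) α).symm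
      _ = α := by rw [hh', hg']
  inv_mem' := by
    rintro g ⟨hg, hg'⟩
    refine ⟨fun x y => by simpa using (hg (g⁻¹ x) (g⁻¹ y)).symm, ?_⟩
    have key : ∀ p : Placement cs F, Placement.map g⁻¹ (Placement.map g p) = p := fun p => by
      cases p with
      | mk t e => simp [Placement.map, Function.comp_def]
    calc Placement.map g⁻¹ '' α = Placement.map g⁻¹ '' (Placement.map g '' α) := by rw [hg']
      _ = α := by rw [Set.image_image]; simp [key]

/-- A tiling is aperiodic if its group of isometries does not act cocompactly. -/
def IsAperiodic {cs : CoxeterSystem M W} {F : Type*} (d : InvariantMetric cs)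
    (α : Set (Placement cs F)) : Prop :=
  ¬ ∃ A : Set (Complex cs), IsCompact A ∧ ⋃ g ∈ isometryGroup d α, g '' A = Set.univ

end Davis

end

open Topology Set Metric

namespace Davis

variable {B W F K : Type*} [Group W] {M : CoxeterMatrix B} {cs : CoxeterSystem M W}

/-! ### The chamber -/

/-! Suppose the isometries of a tiling act cocompactly. Then the placed tiles fall into finitely
many orbits (`finite_orbits`). Consider the finite set of pairs (orbit, face index), each weighted
by `w` of the face. Crossing a face leads to the neighboring tile and to the opposite face there;
this is an involution that negates the weight, so the total weight is zero. But the total is also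
the sum over the orbits of the sums over single tiles, all of which are positive: a contradiction.

Two geometric facts make this work. The neighbor across a face is unique (`meet_unique`), because
two adjacent tiles share a point that lies in no third tile; hence crossing a face is an involution
and commutes with isometries. The tiling is locally finite (`finite_apex_mem`), because a small
connected set contains the apex of at most one placed tile; local connectedness of the complex
provides such sets around every point. -/

theorem finite_special_empty (cs : CoxeterSystem M W) : Finite (special cs ∅) := by
  have h : special cs ∅ = ⊥ := by simp [special]
  rw [h]
  infer_instance

theorem finite_special_singleton (cs : CoxeterSystem M W) (s : B) :
    Finite (special cs {s}) := by
  have h : special cs {s} = Subgroup.zpowers (cs.simple s) := by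
    simp [special, Subgroup.zpowers_eq_closure]
  rw [h]
  change Finite ((Subgroup.zpowers (cs.simple s) : Set W) : Type _)
  rw [Set.finite_coe_iff, finite_zpowers]
  exact isOfFinOrder_iff_pow_eq_one.2 ⟨2, two_pos, cs.simple_sq s⟩

variable [Fintype B]

open Classical in
/-- A vertex of the chamber. -/
noncomputable def vertex (σ : Spherical cs) : Chamber cs :=
  ⟨Pi.single σ 1, single_mem_stdSimplex ℝ σ, by
    intro a ha b hb hab
    have h : ∀ c : Spherical cs, (Pi.single σ 1 : Spherical cs → ℝ) c ≠ 0 → c = σ := fun c hc => by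
      by_contra hne
      exact hc (Pi.single_eq_of_ne hne 1)
    exact absurd ((h a ha).trans (h b hb).symm) hab⟩

theorem vertex_apply_self (σ : Spherical cs) : (vertex σ).1 σ = 1 := by
  simp [vertex]

theorem eq_of_vertex_apply_ne_zero {σ ρ : Spherical cs} (h : (vertex σ).1 ρ ≠ 0) : ρ = σ := by
  classical
  by_contra hne
  exact h (by simp [vertex, hne])

/-- The empty spherical subset. -/
def emptySpherical (cs : CoxeterSystem M W) : Spherical cs := ⟨∅, finite_special_empty cs⟩

/-- The cone vertex of the chamber. -/
noncomputable def apex (cs : CoxeterSystem M W) : Chamber cs := vertex (emptySpherical cs)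

theorem notMem_mirror_of_apply_empty_ne_zero {x : Chamber cs} (h : x.1 (emptySpherical cs) ≠ 0)
    (s : B) : x ∉ mirror cs s := fun hx => by
  simpa [emptySpherical] using hx _ h

theorem apex_notMem_mirror (s : B) : apex cs ∉ mirror cs s :=
  notMem_mirror_of_apply_empty_ne_zero
    (by rw [apex, vertex_apply_self]; exact one_ne_zero) s

/-- The vertex `{s}` lies in the `s`-mirror and in no other one. As the tiling conditions compare
faces as subsets, this is what recovers the index of a face. -/
theorem mirror_injective (cs : CoxeterSystem M W) : Function.Injective (mirror cs) := by
  intro s t h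
  have hs : vertex ⟨{s}, finite_special_singleton cs s⟩ ∈ mirror cs s := fun σ hσ => by
    simp [eq_of_vertex_apply_ne_zero hσ]
  rw [h] at hs
  have := hs ⟨{s}, finite_special_singleton cs s⟩
    (by rw [vertex_apply_self]; exact one_ne_zero)
  exact (Finset.mem_singleton.1 this).symm

theorem isClosed_mirror (s : B) : IsClosed (mirror cs s) := by
  have h : mirror cs s = ⋂ (σ : Spherical cs) (_ : s ∉ σ.1), {x : Chamber cs | x.1 σ = 0} := by
    ext x
    simp only [mirror, mem_ofPred_eq, mem_iInter]
    exact forall_congr' fun σ => not_imp_comm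
  rw [h]
  exact isClosed_iInter fun σ => isClosed_iInter fun _ =>
    isClosed_eq ((continuous_apply σ).comp continuous_subtype_val) continuous_const

/-- The support is a chain exactly when, of any two incomparable indices, one has coordinate zero.
-/
theorem isClosed_chain_support {ι : Type*} [LE ι] :
    IsClosed {x : ι → ℝ | IsChain (· ≤ ·) {σ | x σ ≠ 0}} := by
  have h : {x : ι → ℝ | IsChain (· ≤ ·) {σ | x σ ≠ 0}} =
      ⋂ (σ : ι) (ρ : ι) (_ : σ ≠ ρ ∧ ¬ (σ ≤ ρ ∨ ρ ≤ σ)), {x | x σ = 0} ∪ {x | x ρ = 0} := by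
    ext x
    simp only [IsChain, Set.Pairwise, mem_ofPred_eq, mem_iInter, mem_union]
    refine ⟨fun h σ ρ hσ => ?_, fun h σ hσ ρ hρ hne => ?_⟩
    · by_contra! hc
      exact hσ.2 (h hc.1 hc.2 hσ.1)
    · by_contra hc
      rcases h σ ρ ⟨hne, hc⟩ with h | h
      exacts [hσ h, hρ h]
  rw [h]
  exact isClosed_iInter fun σ => isClosed_iInter fun ρ => isClosed_iInter fun _ =>
    (isClosed_eq (continuous_apply σ) continuous_const).union
      (isClosed_eq (continuous_apply ρ) continuous_const)

instance (cs : CoxeterSystem M W) : CompactSpace (Chamber cs) :=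
  isCompact_iff_compactSpace.1 ((isCompact_stdSimplex ℝ (Spherical cs)).inter_right
    isClosed_chain_support)

/-- Two points whose supports lie in a common chain span a segment in the chamber. -/
theorem segment_mem_chamber {x y z : Spherical cs → ℝ} {a b : ℝ}
    (hx : x ∈ stdSimplex ℝ (Spherical cs)) (hy : y ∈ stdSimplex ℝ (Spherical cs))
    (hz : IsChain (· ≤ ·) {σ : Spherical cs | x σ ≠ 0 ∨ y σ ≠ 0})
    (ha : 0 ≤ a) (hb : 0 ≤ b) (hab : a + b = 1) (h : a • x + b • y = z) :
    z ∈ stdSimplex ℝ (Spherical cs) ∧ IsChain (· ≤ ·) {σ : Spherical cs | z σ ≠ 0} := by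
  subst h
  refine ⟨convex_stdSimplex ℝ _ hx hy ha hb hab, hz.mono fun σ hσ => ?_⟩
  by_contra hc
  obtain ⟨hx0, hy0⟩ : x σ = 0 ∧ y σ = 0 := by simpa using hc
  exact hσ (by simp [hx0, hy0])

theorem exists_pos_forall_apply_ne_zero {ι : Type*} [Fintype ι] (x : ι → ℝ) :
    ∃ δ > 0, ∀ y ∈ ball x δ, ∀ i, x i ≠ 0 → y i ≠ 0 := by
  have h : {y : ι → ℝ | ∀ i, x i ≠ 0 → y i ≠ 0} ∈ 𝓝 x := by
    refine Filter.eventually_all.2 fun i => ?_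
    by_cases hi : x i = 0
    · simp [hi]
    · filter_upwards [(continuous_apply i).continuousAt.eventually_ne hi] with y hy _ using hy
  obtain ⟨δ, hδ, h⟩ := Metric.mem_nhds_iff.1 h
  exact ⟨δ, hδ, fun y hy => h hy⟩

/-- In a ball so small that no nonzero coordinate of the center vanishes, the support of each point
contains that of the center. Segments to the center then stay in the chamber, so the ball is
star-shaped. -/
instance (cs : CoxeterSystem M W) : LocallyPathConnectedSpace (Chamber cs) := by
  refine .of_bases (p := fun x ε => 0 < ε ∧ ∀ y ∈ ball x.1 ε, ∀ i, x.1 i ≠ 0 → y i ≠ 0)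
    (s := fun x ε => ball x ε) (fun x => ?_) fun x ε hε => ?_
  · obtain ⟨δ, hδ, h⟩ := exists_pos_forall_apply_ne_zero x.1
    refine nhds_basis_ball.to_hasBasis (fun ε hε => ⟨min ε δ, ⟨lt_min hε hδ, fun y hy => ?_⟩, ?_⟩)
      fun ε hε => ⟨ε, hε.1, subset_rfl⟩
    · exact h y (ball_subset_ball (min_le_right _ _) hy)
    · exact ball_subset_ball (min_le_left _ _)
  · have hi : IsInducing (Subtype.val : Chamber cs → Spherical cs → ℝ) := .subtypeVal
    rw [hi.isPathConnected_iff]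
    refine StarConvex.isPathConnected (a := x.1) ?_ ⟨x, mem_ball_self hε.1, rfl⟩
    rintro _ ⟨y, hy, rfl⟩ a b ha hb hab
    have hsub : ∀ σ, x.1 σ ≠ 0 ∨ y.1 σ ≠ 0 → y.1 σ ≠ 0 := fun σ hσ =>
      hσ.elim (hε.2 y.1 hy σ) id
    exact ⟨⟨_, segment_mem_chamber x.2.1 y.2.1 (y.2.2.mono hsub) ha hb hab rfl⟩,
      convex_ball x.1 ε (mem_ball_self hε.1) hy ha hb hab, rfl⟩

/-- A point is pushed along the segment to the cone vertex: as soon as it moves, its coordinate at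
the empty set is positive, which keeps it off all mirrors. -/
theorem dense_compl_mirrors (cs : CoxeterSystem M W) :
    Dense (⋃ s, mirror cs s)ᶜ := by
  intro x
  have hch : IsChain (· ≤ ·) {σ : Spherical cs | x.1 σ ≠ 0 ∨ (apex cs).1 σ ≠ 0} := by
    have hbot : ∀ σ : Spherical cs, (apex cs).1 σ ≠ 0 → ∀ ρ : Spherical cs, σ ≤ ρ := fun σ h ρ => by
      rw [eq_of_vertex_apply_ne_zero h]
      exact Finset.empty_subset _
    rintro σ (hσ | hσ) ρ (hρ | hρ) hne
    · exact x.2.2 hσ hρ hne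
    · exact Or.inr (hbot ρ hρ σ)
    · exact Or.inl (hbot σ hσ ρ)
    · exact Or.inl (hbot σ hσ ρ)
  let f : unitInterval → Chamber cs := fun t =>
    ⟨(1 - t : ℝ) • x.1 + (t : ℝ) • (apex cs).1,
      segment_mem_chamber x.2.1 (apex cs).2.1 hch (sub_nonneg.2 t.2.2) t.2.1 (by ring) rfl⟩
  have hf : Continuous f := by
    apply Continuous.subtype_mk
    fun_prop
  have h0 : f 0 = x := Subtype.ext (by simp [f])
  rw [← h0]
  refine map_mem_closure (s := Ioi 0) hf ?_ fun t ht => ?_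
  · rw [closure_Ioi' ⟨1, zero_lt_one⟩]
    exact self_mem_Ici
  · simp only [mem_compl_iff, mem_iUnion, not_exists]
    refine notMem_mirror_of_apply_empty_ne_zero (ne_of_gt ?_)
    have hx := x.2.1.1 (emptySpherical cs)
    have ht' : (0 : ℝ) < t := ht
    have h1 : (0 : ℝ) ≤ 1 - t := sub_nonneg.2 t.2.2
    simp only [f, Pi.add_apply, Pi.smul_apply, smul_eq_mul, apex, vertex_apply_self]
    have := mul_nonneg h1 hx
    linarith

/-! ### The Davis complex -/

theorem mk_injective (γ : W) : Function.Injective (mk cs γ) := fun _ _ h =>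
  (Quotient.exact h : _ ∧ _).1

theorem continuous_mk (γ : W) : Continuous (mk cs γ) :=
  continuous_quotient_mk'.comp continuous_sigmaMk

/-- Local path connectedness passes from the chamber to disjoint unions and to quotients. -/
instance (cs : CoxeterSystem M W) : LocallyPathConnectedSpace (Complex cs) :=
  inferInstanceAs (LocallyPathConnectedSpace (Quotient (gluing cs)))

/-- The metric space structure of an invariant metric; its topology is the quotient topology. -/
abbrev InvariantMetric.metricSpace (d : InvariantMetric cs) : MetricSpace (Complex cs) :=
  .ofDistTopology d.dist d.dist_self d.dist_comm d.dist_triangle d.isOpen_iff d.eq_of_dist_eq_zero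

theorem InvariantMetric.t2Space (d : InvariantMetric cs) : T2Space (Complex cs) :=
  let := d.metricSpace
  inferInstance

theorem InvariantMetric.continuous_of_dist_eq {Y : Type*} [TopologicalSpace Y]
    (d : InvariantMetric cs) {f g : Y → Complex cs} (hf : Continuous f)
    (h : ∀ x y, d.dist (g x) (g y) = d.dist (f x) (f y)) : Continuous g := by
  let := d.metricSpace
  rw [continuous_iff_continuousAt]
  intro x
  refine tendsto_iff_dist_tendsto_zero.2 ?_
  have := tendsto_iff_dist_tendsto_zero.1 (hf.tendsto x)
  exact this.congr fun y => (h y x).symm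

/-- A bijection that preserves the metric, as a homeomorphism. -/
def InvariantMetric.homeomorph (d : InvariantMetric cs) (g : Equiv.Perm (Complex cs))
    (hg : ∀ x y, d.dist (g x) (g y) = d.dist x y) : Complex cs ≃ₜ Complex cs where
  toEquiv := g
  continuous_toFun := d.continuous_of_dist_eq continuous_id hg
  continuous_invFun := d.continuous_of_dist_eq continuous_id fun x y => by
    simpa using (hg (g.symm x) (g.symm y)).symm

namespace IsTiling

variable {d : InvariantMetric cs} {τ : B → K} {T : Set (Tile B F)} {α : Set (Placement cs F)}
  {p q r : Placement cs F}

/-! ### Topology of a tiling -/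

theorem continuous_emb (hα : IsTiling d τ T α) (hp : p ∈ α) : Continuous p.emb :=
  d.continuous_of_dist_eq (continuous_mk 1) (hα.isometric p hp)

theorem emb_injective (hα : IsTiling d τ T α) (hp : p ∈ α) : Function.Injective p.emb := by
  intro x y h
  refine mk_injective (cs := cs) 1 (d.eq_of_dist_eq_zero _ _ ?_)
  rw [← hα.isometric p hp, h, d.dist_self]

theorem face_injective (hα : IsTiling d τ T α) (hp : p ∈ α) : Function.Injective p.face :=
  (hα.emb_injective hp).image_injective.comp (mirror_injective cs)

theorem isClosed_carrier (hα : IsTiling d τ T α) (hp : p ∈ α) : IsClosed p.carrier :=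
  have := d.t2Space
  (isCompact_range (hα.continuous_emb hp)).isClosed

theorem interior_carrier (hα : IsTiling d τ T α) (hp : p ∈ α) :
    interior p.carrier = p.emb '' (⋃ s, mirror cs s)ᶜ := by
  rw [← hα.interior_eq p hp, compl_eq_univ_sdiff, image_sdiff (hα.emb_injective hp), image_univ,
    image_iUnion]
  rfl

theorem carrier_subset_closure_interior (hα : IsTiling d τ T α) (hp : p ∈ α) :
    p.carrier ⊆ closure (interior p.carrier) := by
  rw [hα.interior_carrier hp]
  exact (hα.continuous_emb hp).range_subset_closure_image_dense (dense_compl_mirrors cs)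

/-- A placed tile lies in the closure of its interior, and an open set disjoint from a set is
disjoint from its closure. -/
theorem disjoint_interior_carrier (hα : IsTiling d τ T α) (hp : p ∈ α) (hq : q ∈ α)
    (hpq : p ≠ q) : Disjoint (interior p.carrier) q.carrier :=
  ((hα.disjoint p hp q hq hpq).closure_right isOpen_interior).mono_right
    (hα.carrier_subset_closure_interior hq)

/-- Some common point of two adjacent tiles is in no third tile. -/
theorem exists_mem_inter_of_adjacent (hα : IsTiling d τ T α) (hp : p ∈ α) (hq : q ∈ α)
    (h : p.Adjacent q) :
    ∃ x ∈ p.carrier ∩ q.carrier, ∀ r ∈ α, x ∈ r.carrier → r = p ∨ r = q := by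
  obtain ⟨x, hx, hx'⟩ : ∃ x ∈ interior (p.carrier ∪ q.carrier),
      x ∉ interior p.carrier ∪ interior q.carrier := by
    by_contra! hc
    exact h (Subset.antisymm hc (union_subset (interior_mono subset_union_left)
      (interior_mono subset_union_right)))
  -- If `x` missed the closed set `v`, a neighborhood of `x` would lie in `u` alone. Hence `x`
  -- belongs to both tiles.
  have key : ∀ u v : Set (Complex cs), IsClosed v → x ∈ interior (u ∪ v) → x ∉ interior u →
      x ∈ v := by
    intro u v hv hx hxu
    by_contra hxv
    refine hxu (mem_interior.2 ⟨interior (u ∪ v) ∩ vᶜ, fun y hy => ?_,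
      isOpen_interior.inter hv.isOpen_compl, hx, hxv⟩)
    exact (interior_subset hy.1).resolve_right hy.2
  refine ⟨x, ⟨key q.carrier p.carrier (hα.isClosed_carrier hp) (by rwa [union_comm])
    fun hxq => hx' (Or.inr hxq), key p.carrier q.carrier (hα.isClosed_carrier hq) hx
    fun hxp => hx' (Or.inl hxp)⟩, fun r hr hxr => ?_⟩
  by_contra! hc
  -- A third tile through `x` would have interior points in the neighborhood `interior (p.carrier ∪
  -- q.carrier)`, hence in `p` or `q`.
  obtain ⟨y, hy, hyr⟩ := mem_closure_iff.1 (hα.carrier_subset_closure_interior hr hxr) _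
    isOpen_interior hx
  rcases interior_subset hy with hy | hy
  · exact disjoint_left.1 (hα.disjoint_interior_carrier hr hp hc.1) hyr hy
  · exact disjoint_left.1 (hα.disjoint_interior_carrier hr hq hc.2) hyr hy

/-! ### Local finiteness -/

theorem apex_mem_interior (hα : IsTiling d τ T α) (hp : p ∈ α) :
    p.emb (apex cs) ∈ interior p.carrier := by
  rw [hα.interior_carrier hp]
  exact mem_image_of_mem _ (by simpa using apex_notMem_mirror)

end IsTiling

/-- The mirrors of the chamber have a positive distance from the cone vertex. -/
theorem InvariantMetric.exists_pos_le_dist_apex (d : InvariantMetric cs) :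
    ∃ ε > 0, ∀ s, ∀ x ∈ mirror cs s, ε ≤ d.dist (Davis.mk cs 1 (apex cs)) (Davis.mk cs 1 x) := by
  have := d.t2Space
  have hK : IsClosed (⋃ s, Davis.mk cs 1 '' mirror cs s) := isClosed_iUnion_of_finite fun s =>
    ((isClosed_mirror s).isCompact.image (continuous_mk 1)).isClosed
  obtain ⟨ε, hε, h⟩ := (d.isOpen_iff _).1 hK.isOpen_compl (Davis.mk cs 1 (apex cs)) (by
    simp only [mem_compl_iff, mem_iUnion, (mk_injective (cs := cs) 1).mem_set_image]
    exact fun ⟨s, hs⟩ => apex_notMem_mirror s hs)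
  refine ⟨ε, hε, fun s x hx => ?_⟩
  by_contra! hlt
  exact h _ hlt (mem_iUnion.2 ⟨s, mem_image_of_mem _ hx⟩)

/-- Arbitrarily small connected open neighborhoods. -/
theorem InvariantMetric.exists_isOpen_isPreconnected (d : InvariantMetric cs) {ε : ℝ}
    (hε : 0 < ε) (a : Complex cs) : ∃ V : Set (Complex cs), IsOpen V ∧ a ∈ V ∧
      IsPreconnected V ∧ ∀ x ∈ V, ∀ y ∈ V, d.dist x y < ε := by
  let := d.metricSpace
  obtain ⟨V, hV, hVo, haV, hVc⟩ := locallyConnectedSpace_iff_subsets_isOpen_isConnected.1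
    (inferInstanceAs (LocallyConnectedSpace (Complex cs))) a _
    (ball_mem_nhds a (half_pos hε))
  refine ⟨V, hVo, haV, hVc.isPreconnected, fun x hx y hy => ?_⟩
  have h1 : Dist.dist x a < ε / 2 := hV hx
  have h2 : Dist.dist y a < ε / 2 := hV hy
  have h3 : Dist.dist x y ≤ Dist.dist x a + Dist.dist y a := dist_triangle_right x y a
  exact lt_of_le_of_lt h3 (by linarith)

namespace IsTiling

variable {d : InvariantMetric cs} {τ : B → K} {T : Set (Tile B F)} {α : Set (Placement cs F)}
  {p q r : Placement cs F}

/-- The set `V` is too small to reach a face of `p` from the apex of `p`, so it is covered by the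
interior and the complement of `p`. It is connected and meets the interior, so it cannot contain the
apex of another tile, which lies outside `p`. -/
theorem eq_of_apex_mem (hα : IsTiling d τ T α) (hp : p ∈ α) (hq : q ∈ α) {ε : ℝ}
    (hε : ∀ s, ∀ x ∈ mirror cs s, ε ≤ d.dist (Davis.mk cs 1 (apex cs)) (Davis.mk cs 1 x))
    {V : Set (Complex cs)} (hV : IsPreconnected V) (hd : ∀ x ∈ V, ∀ y ∈ V, d.dist x y < ε)
    (hpV : p.emb (apex cs) ∈ V) (hqV : q.emb (apex cs) ∈ V) : p = q := by
  by_contra hpq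
  have hqp : q.emb (apex cs) ∉ p.carrier :=
    disjoint_left.1 (hα.disjoint_interior_carrier hq hp (Ne.symm hpq)) (hα.apex_mem_interior hq)
  have hsub : V ⊆ interior p.carrier ∪ p.carrierᶜ := by
    intro y hy
    by_contra hc
    obtain ⟨hy1, hy2⟩ : y ∉ interior p.carrier ∧ y ∈ p.carrier := by simpa using hc
    rw [← hα.interior_eq p hp] at hy1
    obtain ⟨s, x, hx, rfl⟩ : ∃ s, y ∈ p.face s := by simpa [hy2] using hy1
    have := hd _ hpV _ hy
    rw [hα.isometric p hp] at this
    exact (hε s x hx).not_gt this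
  obtain ⟨y, -, hy1, hy2⟩ := hV _ _ isOpen_interior (hα.isClosed_carrier hp).isOpen_compl hsub
    ⟨_, hpV, hα.apex_mem_interior hp⟩ ⟨_, hqV, hqp⟩
  exact hy2 (interior_subset hy1)

theorem finite_apex_mem (hα : IsTiling d τ T α) {A : Set (Complex cs)} (hA : IsCompact A) :
    {p ∈ α | p.emb (apex cs) ∈ A}.Finite := by
  obtain ⟨ε, hε, h⟩ := d.exists_pos_le_dist_apex
  choose V hVo haV hVc hVd using d.exists_isOpen_isPreconnected hε
  obtain ⟨t, -, ht⟩ := hA.elim_nhds_subcover V fun x _ => (hVo x).mem_nhds (haV x)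
  refine (t.finite_toSet.biUnion (t := fun a => {p ∈ α | p.emb (apex cs) ∈ V a})
    fun a _ => Set.Subsingleton.finite ?_).subset fun p hp => ?_
  · exact fun p hp q hq => hα.eq_of_apex_mem hp.1 hq.1 h (hVc a) (hVd a) hp.2 hq.2
  · obtain ⟨a, ha, hpa⟩ := mem_iUnion₂.1 (ht hp.2)
    exact mem_iUnion₂.2 ⟨a, ha, hp.1, hpa⟩

end IsTiling

/-! ### Neighbors -/

/-- The placed tiles `p` and `q` are adjacent and meet exactly along the `s`-face of `p`,
which is the `s'`-face of `q`. -/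
structure Placement.Meet (p : Placement cs F) (s : B) (q : Placement cs F) (s' : B) : Prop where
  ne : p ≠ q
  adjacent : p.Adjacent q
  left : p.carrier ∩ q.carrier = p.face s
  right : p.carrier ∩ q.carrier = q.face s'

theorem Placement.Meet.symm {p q : Placement cs F} {s s' : B} (h : p.Meet s q s') :
    q.Meet s' p s where
  ne := h.ne.symm
  adjacent := by
    have := h.adjacent
    rwa [Placement.Adjacent, union_comm, union_comm (interior _)] at this
  left := by rw [inter_comm, h.right]
  right := by rw [inter_comm, h.left]

theorem Placement.carrier_map (g : Equiv.Perm (Complex cs)) (p : Placement cs F) :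
    (p.map g).carrier = g '' p.carrier := range_comp g p.emb

theorem Placement.face_map (g : Equiv.Perm (Complex cs)) (p : Placement cs F) (s : B) :
    (p.map g).face s = g '' p.face s := image_comp g p.emb _

theorem Placement.map_injective (g : Equiv.Perm (Complex cs)) :
    Function.Injective (Placement.map (F := F) g) := by
  rintro ⟨t, e⟩ ⟨t', e'⟩ h
  simp only [Placement.map, Placement.mk.injEq] at h
  rw [h.1, g.injective.comp_left h.2]

theorem Placement.Meet.map {p q : Placement cs F} {s s' : B} (h : p.Meet s q s')
    (d : InvariantMetric cs) {g : Equiv.Perm (Complex cs)}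
    (hg : ∀ x y, d.dist (g x) (g y) = d.dist x y) : (p.map g).Meet s (q.map g) s' where
  ne := (Placement.map_injective g).ne h.ne
  adjacent := by
    have hi : ∀ u : Set (Complex cs), interior (g '' u) = g '' interior u := fun u =>
      ((d.homeomorph g hg).image_interior u).symm
    rw [Placement.Adjacent, carrier_map, carrier_map, ← image_union, hi, hi, hi, ← image_union]
    exact g.injective.image_injective.ne h.adjacent
  left := by rw [carrier_map, carrier_map, ← image_inter g.injective, h.left, face_map]
  right := by rw [carrier_map, carrier_map, ← image_inter g.injective, h.right, face_map]

namespace IsTiling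

variable {d : InvariantMetric cs} {τ : B → K} {T : Set (Tile B F)} {α : Set (Placement cs F)}
  {p q r : Placement cs F}

/-- The tiling condition yields some pair of opposite faces; injectivity of `face` identifies it
with the given pair. -/
theorem faceOf_eq_of_meet (hα : IsTiling d τ T α) (hp : p ∈ α) (hq : q ∈ α) {s s' : B}
    (h : p.Meet s q s') : faceOf τ q.tile s' = opposite (faceOf τ p.tile s) := by
  obtain ⟨t, t', ht, ht', he⟩ := hα.opposite_faces p hp q hq h.ne h.adjacent
  rwa [hα.face_injective hp (ht.symm.trans h.left),
    hα.face_injective hq (ht'.symm.trans h.right)] at he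

theorem exists_meet (hα : IsTiling d τ T α) (hp : p ∈ α) (s : B) :
    ∃ q ∈ α, ∃ s', p.Meet s q s' := by
  obtain ⟨q, hq, hne, hadj, h⟩ := hα.no_free_face p hp s
  obtain ⟨_, s', -, h', -⟩ := hα.opposite_faces p hp q hq hne hadj
  exact ⟨q, hq, s', hne, hadj, h, h'⟩

/-- A common point of `p` and `q` that is in no third tile lies in the `s`-face of `p`, hence also
in `r`. -/
theorem meet_unique (hα : IsTiling d τ T α) (hp : p ∈ α) (hq : q ∈ α) (hr : r ∈ α) {s s' s'' : B}
    (h : p.Meet s q s') (h' : p.Meet s r s'') : q = r ∧ s' = s'' := by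
  obtain ⟨x, hx, hx'⟩ := hα.exists_mem_inter_of_adjacent hp hq h.adjacent
  have hxr : x ∈ p.carrier ∩ r.carrier := by rwa [h'.left, ← h.left]
  have hqr : q = r := ((hx' r hr hxr.2).resolve_left h'.ne.symm).symm
  subst hqr
  exact ⟨rfl, hα.face_injective hq (h.right.symm.trans h'.right)⟩

/-! ### The sum over a fundamental domain -/

/-- Placed tiles of a tiling in the same orbit under the isometries of the tiling. -/
def orbitSetoid (d : InvariantMetric cs) (α : Set (Placement cs F)) : Setoid α where
  r p q := ∃ g ∈ isometryGroup d α, p.1.map g = q.1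
  iseqv :=
    { refl := fun p => ⟨1, one_mem _, rfl⟩
      symm := by
        rintro p q ⟨g, hg, h⟩
        refine ⟨g⁻¹, inv_mem hg, Placement.map_injective g ?_⟩
        rw [h, ← h]
        simp [Placement.map, ← Function.comp_assoc]
      trans := by
        rintro p q r ⟨g, hg, h⟩ ⟨g', hg', h'⟩
        exact ⟨g' * g, mul_mem hg' hg, by rw [← h', ← h]; rfl⟩ }

theorem finite_orbits (hα : IsTiling d τ T α) {A : Set (Complex cs)} (hA : IsCompact A)
    (hcov : ⋃ g ∈ isometryGroup d α, g '' A = univ) : Finite (Quotient (orbitSetoid d α)) := by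
  have hfin : Finite {p ∈ α | p.emb (apex cs) ∈ A} := hα.finite_apex_mem hA
  let f : {p ∈ α | p.emb (apex cs) ∈ A} → Quotient (orbitSetoid d α) :=
    fun p => Quotient.mk _ ⟨p.1, p.2.1⟩
  refine Finite.of_surjective f ?_
  rintro ⟨p, hp⟩
  obtain ⟨g, hg, x, hx, hgx⟩ := mem_iUnion₂.1 (hcov.ge (mem_univ (p.emb (apex cs))))
  -- The apex of `p` is the image under `g` of a point of `A`, so `g⁻¹` brings the tile to one with
  -- apex in `A`.
  have hmem : p.map g⁻¹ ∈ α := (inv_mem hg).2 ▸ mem_image_of_mem _ hp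
  refine ⟨⟨p.map g⁻¹, hmem, ?_⟩, Quotient.sound ⟨g, hg, ?_⟩⟩
  · simpa [Placement.map, ← hgx] using hx
  · simp [Placement.map, ← Function.comp_assoc]

theorem nonempty (hα : IsTiling d τ T α) : α.Nonempty := by
  obtain ⟨p, hp, -⟩ := mem_iUnion₂.1 (hα.cover.ge (mem_univ (Davis.mk cs 1 (apex cs))))
  exact ⟨p, hp⟩

theorem isAperiodic_of_isUnbalanced (hα : IsTiling d τ T α) (hT : IsUnbalanced τ T) :
    IsAperiodic d α := by
  rintro ⟨A, hA, hcov⟩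
  obtain ⟨w, hw, hpos⟩ := hT
  have := hα.finite_orbits hA hcov
  have := Fintype.ofFinite (Quotient (orbitSetoid d α))
  choose nb hnb face hface using fun (p : α) s => hα.exists_meet p.2 s
  -- An isometry of the tiling carries the neighbor of `p` to a tile that meets its image `q` along
  -- the same face, and such a tile is unique.
  have hcongr : ∀ p q : α, orbitSetoid d α p q → ∀ s,
      orbitSetoid d α ⟨nb p s, hnb p s⟩ ⟨nb q s, hnb q s⟩ ∧ face p s = face q s := by
    rintro p q ⟨g, hg, hpq⟩ s
    have h1 := (hface p s).map d hg.1
    rw [hpq] at h1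
    have h2 := hα.meet_unique q.2 (hg.2 ▸ mem_image_of_mem _ (hnb p s)) (hnb q s) h1 (hface q s)
    exact ⟨⟨g, hg, h2.1⟩, h2.2⟩
  let weight : Quotient (orbitSetoid d α) × B → ℤ := fun x =>
    x.1.lift (fun p => w (faceOf τ p.1.tile x.2)) (by
      rintro p q ⟨g, -, h⟩
      rw [← h]
      rfl)
  let inv : Quotient (orbitSetoid d α) × B → Quotient (orbitSetoid d α) × B := fun x =>
    x.1.lift (fun p => (Quotient.mk _ ⟨nb p x.2, hnb p x.2⟩, face p x.2)) (fun p q h =>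
      Prod.ext (Quotient.sound (hcongr p q h x.2).1) (hcongr p q h x.2).2)
  -- Seen from the neighbor, `p` itself lies across the common face.
  have hinv : Function.Involutive inv := by
    rintro ⟨⟨p⟩, s⟩
    have h := hα.meet_unique (hnb p s) (hnb ⟨nb p s, hnb p s⟩ (face p s)) p.2
      (hface ⟨nb p s, hnb p s⟩ (face p s)) (hface p s).symm
    exact Prod.ext (congrArg (Quotient.mk _) (Subtype.ext h.1)) h.2
  have hneg : ∀ x, weight (inv x) = -weight x := by
    rintro ⟨⟨p⟩, s⟩
    exact (congrArg w (hα.faceOf_eq_of_meet p.2 (hnb p s) (hface p s))).trans (hw _)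
  -- Reindexing by `inv` shows that the sum equals its own negative; fixed points of `inv` do no
  -- harm.
  have hzero : ∑ x, weight x = 0 := by
    have h := Equiv.sum_comp hinv.toPerm weight
    simp only [Function.Involutive.coe_toPerm, hneg, Finset.sum_neg_distrib] at h
    linarith
  obtain ⟨p, hp⟩ := hα.nonempty
  rw [Fintype.sum_prod_type] at hzero
  refine hzero.not_gt (Finset.sum_pos ?_ ⟨Quotient.mk _ ⟨p, hp⟩, Finset.mem_univ _⟩)
  rintro ⟨p⟩ -
  exact hpos _ (hα.tile_mem p.1 p.2)

end IsTiling

end Davis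

theorem proposition10 {B W F K : Type*} [Fintype B] [Group W] [Finite F]
    {M : CoxeterMatrix B} (cs : CoxeterSystem M W) (d : Davis.InvariantMetric cs)
    (φ : Davis.Wall cs → F) (o : Davis.Orientation cs) (τ : B → K)
    (T : Set (Davis.Tile B F)) (hT : Davis.resolutionTiles φ o ⊆ T)
    (hunb : Davis.IsUnbalanced τ T)
    (α : Set (Davis.Placement cs F)) (hα : Davis.IsTiling d τ T α) :
    Davis.IsAperiodic d α :=
  hα.isAperiodic_of_isUnbalanced hunb
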